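/- **Setting.** All logarithms are to base $2$ and entropies are in bits. Let $V$ be a finite set of nodes. An *oblivious network model* $M$ on $V$ specifies, for every round $t$ and given the edge sets $E_1,\dots,E_{t-1}$ of the earlier rounds, a probability distribution of the set $E_t\subseteq V\times V$ of active directed edges. For $p\in[0,1]$ and $S\subseteq V$ the flooding process $F(M,p,S)$ is $S_1=S$, $S_{t+1}=S_t\cup\{v:\exists u\in S_t,\ (u,v)\in E'_t\}$, where $E'_t$ arises from $E_t$ by keeping each edge independently with probability $1-p$; let $S_F=\min\{t\ge 1: S_t=V\}\in\mathbb N\cup\{\infty\}$. The model $M$ *floods in time $T\in\mathbb{R}$ with throughput $\alpha>0$*, witnessed by the prime power $q$, if $P[S_{F(M,1/q,\{v\})}\ge T+k]<q^{-\alpha k}$ for all $v\in V$ and all real $k>0$. Let $X$ and $(Y_v)_{v\in V}$ be random variables with finite alphabets $\mathcal X$ and $\mathcal Y_v$ and an arbitrary joint law. The message $x\in\mathcal X^l$ and the side information $y_v\in\mathcal Y_v^l$, $v\in V$, consist of $l$ i.i.d. samples of $(X,(Y_v)_{v\in V})$; each node $v$ holds $y_v$, and the message $x$ is given to every node of a nonempty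 set of source nodes. **Coding scheme** with field $\mathbb F_q$, slack $\delta>0$, and packet size $s=m\log q$ bits for an integer $m\ge 1$ ($m$ symbols of $\mathbb F_q$ per packet, header not counted). Every sequence in $\mathcal X^l$ is assigned independently and uniformly to one of $\lceil 2^{l(H(X)+\delta)}\rceil$ bins; this assignment is known to all nodes. Bin indices are written, by a fixed injective labelling, as vectors of length $h=\lceil\frac{l}{\log q}(H(X)+\delta)\rceil$ over $\mathbb F_q$, and these are split into $\lceil h/m\rceil$ blocks of $m$ symbols (the last one filled up with zeros). A source node initially stores all blocks of the bin index of $x$, the other nodes store no packets. In each round, along every active edge $(u,v)$, node $v$ receives from $u$ a linear combination, with fresh independent uniform coefficients in $\mathbb F_q$ (independent also between edges), of the packets stored at $u$ at the beginning of the round, and stores it. Each packet carries in its header its coefficient vector with respect to the blocks. Samples, bin assignment, network and coefficients are independent. Node $v$ decodes by joint typicality: it outputs the unique sequence that is jointly (weakly) $\eta$-typical with $y_v$ and whose bin index satisfies all linear equations received, and it fails if there is no such sequence or more than one. **Theorem.** Suppose that $M$ floods in time $T$ with throughput $\alpha>0$, and let the scheme use any prime power $q$ that witnesses this. Let $\epsilon>0$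 and $\delta>0$. Then there are a typicality slack $\eta>0$ and a block length $l_0$ such that for every $l\ge l_0$, every packet size $s=m\log q$ with $m\ge1$, every labelling of the bins, every node $v\in V$ and every integer $$t\ \ge\ T'=T+\frac1\alpha\left(\frac{l}{s}\bigl(H(X\mid Y_v)+\delta\bigr)+\log\epsilon^{-1}+3\right),$$ node $v$ correctly decodes $x$ after $t$ rounds with probability at least $1-\epsilon$. -/

import Mathlib

open scoped ENNReal NNReal

noncomputable section

namespace Gossip

/-! Probability and information -/

/-- Probability of the event `A` under the discrete distribution `μ`. -/
def prob {α : Type*} (μ : PMF α) (A : Set α) : ℝ := (μ.toOuterMeasure A).toReal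

/-- Law of a family of independent random variables, the `i`-th one having law `p i`. -/
def indep {ι α : Type*} [Fintype ι] [DecidableEq ι] [Fintype α] (p : ι → PMF α) :
    PMF (ι → α) :=
  PMF.ofFintype (fun z => ∏ i, p i (z i)) (by
    rw [← Fintype.piFinset_univ, ← Finset.prod_univ_sum]
    refine Finset.prod_eq_one fun i _ => ?_
    exact (tsum_fintype (fun a => p i a)).symm.trans (p i).tsum_coe)

/-- Shannon entropy in bits. -/
def entropy {α : Type*} [Fintype α] (μ : PMF α) : ℝ :=
  -∑ a, (μ a).toReal * Real.logb 2 (μ a).toReal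

/-- Conditional entropy `H(X | Y)` in bits of a pair `(X, Y)` with joint law `μ`. -/
def condEntropy {α β : Type*} [Fintype α] [Fintype β] (μ : PMF (α × β)) : ℝ :=
  -∑ a, ∑ b, (μ (a, b)).toReal * Real.logb 2 ((μ (a, b)).toReal / (μ.map Prod.snd b).toReal)

/-- The sequence `x` is weakly `η`-typical for `μ`:
`2^(-l(H + η)) ≤ μ^l(x) ≤ 2^(-l(H - η))`. -/
def Typical {α : Type*} [Fintype α] (μ : PMF α) (η : ℝ) {l : ℕ} (x : Fin l → α) : Prop :=
  (2 : ℝ) ^ (-(l * (entropy μ + η))) ≤ ∏ i, (μ (x i)).toReal ∧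
    ∏ i, (μ (x i)).toReal ≤ (2 : ℝ) ^ (-(l * (entropy μ - η)))

/-- The sequences `x` and `y` are jointly `η`-typical for the joint law `μ`. -/
def JointlyTypical {α β : Type*} [Fintype α] [Fintype β] (μ : PMF (α × β)) (η : ℝ) {l : ℕ}
    (x : Fin l → α) (y : Fin l → β) : Prop :=
  Typical (μ.map Prod.fst) η x ∧ Typical (μ.map Prod.snd) η y ∧
    Typical μ η (fun i => (x i, y i))

/-! Networks and flooding -/

/-- A set of directed edges on `V`; `(u, v)` means that `v` receives a packet from `u`. -/
abbrev EdgeSet (V : Type*) := Finset (V × V)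

/-- An oblivious network model: given the list of the edge sets of all earlier rounds (latest
round first), whose length tells the current time, it specifies the law of the next active
edge set. -/
structure ObliviousModel (V : Type*) where
  next : List (EdgeSet V) → PMF (EdgeSet V)

/-- Law of the active edge sets of the first `t` rounds (latest round first). -/
def ObliviousModel.history {V : Type*} (M : ObliviousModel V) : ℕ → PMF (List (EdgeSet V))
  | 0 => PMF.pure []
  | t + 1 => (M.history t).bind fun h => (M.next h).map fun E => E :: h

section Network

variable {V : Type*} [Fintype V] [DecidableEq V]

/-- A coin showing `true` with probability `1 - p` and `false` with probability `p`
(for `p ≤ 1`, where `1 - (1 - p) = p`). -/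
def coin (p : ℝ≥0) : PMF Bool :=
  PMF.ofFintype (fun b => (((if b then 1 - p else 1 - (1 - p)) : ℝ≥0) : ℝ≥0∞)) (by
    have h : (1 - p) + (1 - (1 - p)) = 1 := add_tsub_cancel_of_le tsub_le_self
    simp only [Fintype.sum_bool, if_true, Bool.false_eq_true, if_false]
    exact_mod_cast h)

/-- Keep each edge of `E` independently with probability `1 - p`. -/
def thinEdges (p : ℝ≥0) (E : EdgeSet V) : PMF (EdgeSet V) :=
  (indep fun _ : V × V => coin p).map
    fun keep => E.filter fun e => keep e = true

/-- Thin the edge sets of all rounds, independently. -/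
def thin (p : ℝ≥0) : List (EdgeSet V) → PMF (List (EdgeSet V))
  | [] => PMF.pure []
  | E :: h => (thin p h).bind fun h' => (thinEdges p E).map fun E' => E' :: h'

/-- The nodes informed after the rounds in the list (latest round first), if the nodes in `S`
are informed at the beginning. After `t` rounds this is the set `S_{t+1}` of the flooding
process, which starts with `S_1 = S`. -/
def informed (S : Finset V) : List (EdgeSet V) → Finset V
  | [] => S
  | E :: h => Finset.univ.filter fun v => ∃ u ∈ informed S h, (u, v) ∈ E ∨ v = u

/-- `P[S_F ≥ r]` for the flooding process `F(M, p, S)`, where `S_F` is the first index `j ≥ 1`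
with `S_j = V`. The suffixes of the list of (thinned) edge sets are the initial segments of
the process, and indices beyond `⌈r⌉` are at least `r`, so the first `⌈r⌉` rounds decide the
event. -/
def floodTail (M : ObliviousModel V) (p : ℝ≥0) (S : Finset V) (r : ℝ) : ℝ :=
  prob ((M.history ⌈r⌉₊).bind (thin p))
    {L | ∀ L', L' <:+ L → informed S L' = Finset.univ → r ≤ (L'.length : ℝ) + 1}

/-- The field size `q` witnesses that `M` floods in time `T` with throughput `α`. -/
def ObliviousModel.Floods (M : ObliviousModel V) (q : ℕ) (T α : ℝ) : Prop :=
  ∀ v : V, ∀ k : ℝ, 0 < k → floodTail M (q : ℝ≥0)⁻¹ {v} (T + k) < (q : ℝ) ^ (-(α * k))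

end Network

/-! The coding scheme -/

/-- Number of bins, `2^(l(H(X) + δ))` rounded up. -/
def numBins {α : Type*} [Fintype α] (μ : PMF α) (δ : ℝ) (l : ℕ) : ℕ :=
  ⌈(2 : ℝ) ^ (l * (entropy μ + δ))⌉₊

instance {α : Type*} [Fintype α] (μ : PMF α) (δ : ℝ) (l : ℕ) : NeZero (numBins μ δ l) :=
  ⟨(Nat.ceil_pos.mpr (Real.rpow_pos_of_pos two_pos _)).ne'⟩

/-- Number `h = ⌈(l / log q)(H(X) + δ)⌉` of symbols describing a bin index. -/
def numSymbols {α : Type*} [Fintype α] (μ : PMF α) (δ : ℝ) (l q : ℕ) : ℕ :=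
  ⌈(l : ℝ) / Real.logb 2 q * (entropy μ + δ)⌉₊

/-- Number of blocks of `m` symbols into which `h` symbols are split. -/
def numBlocks (h m : ℕ) : ℕ := ⌈(h : ℝ) / m⌉₊

section Scheme

variable {V F : Type*} [Fintype V] [DecidableEq V] [Field F] [Fintype F] [DecidableEq F]

/-- Split a vector of `h` symbols into consecutive blocks of `m` symbols, the last block being
filled up with zeros. -/
def blocks {h : ℕ} (m : ℕ) (w : Fin h → F) : Fin (numBlocks h m) → Fin m → F :=
  fun i j => if hij : i.1 * m + j.1 < h then w ⟨i.1 * m + j.1, hij⟩ else 0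

/-- A packet: the coefficient vector in its header, and its payload of `m` symbols. -/
abbrev Packet (F : Type*) (n m : ℕ) := (Fin n → F) × (Fin m → F)

/-- The packet with coefficient vector `c`: its payload is that combination of the blocks. -/
def mkPacket {n m : ℕ} (B : Fin n → Fin m → F) (c : Fin n → F) : Packet F n m :=
  (c, ∑ i, c i • B i)

/-- Coefficient vectors of the packets stored initially: a node holding the message stores all
of the blocks, the other nodes store nothing. -/
def initialStore (src : Finset V) (n : ℕ) : V → Finset (Fin n → F) :=
  fun v => if v ∈ src then Finset.univ.image (fun i => Pi.single i 1) else ∅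

/-- One round: along every active edge `(u, v)` the node `u` sends to `v` the linear combination
of its stored packets with the coefficients `a (u, v)`. -/
def exchange {n : ℕ} (E : EdgeSet V) (L : V → Finset (Fin n → F))
    (a : V × V → (Fin n → F) → F) : V → Finset (Fin n → F) :=
  fun v => L v ∪ (Finset.univ.filter fun u => (u, v) ∈ E).image
    fun u => ∑ c ∈ L u, a (u, v) c • c

/-- Random linear network coding: law of the coefficient vectors of the packets stored at the
nodes, when the active edge sets are those in the list (latest round first). The coefficients of
the linear combinations are independent and uniform over `F`. -/
def gossip (src : Finset V) (n : ℕ) : List (EdgeSet V) → PMF (V → Finset (Fin n → F))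
  | [] => PMF.pure (initialStore src n)
  | E :: h => (gossip src n h).bind fun L =>
      (PMF.uniformOfFintype (V × V → (Fin n → F) → F)).map fun a => exchange E L a

end Scheme

section Decoding

variable {V F 𝒳 : Type*} [Fintype V] [DecidableEq V] [Field F] [Fintype F] [DecidableEq F]
  [Fintype 𝒳] [DecidableEq 𝒳]

/-- The sequence `x` is consistent with the packets in `R`, where `b x` are the blocks of the
bin index of `x`: all the linear equations given by the packets hold. -/
def Consistent {l n m : ℕ} (b : (Fin l → 𝒳) → Fin n → Fin m → F) (R : Finset (Packet F n m))
    (x : Fin l → 𝒳) : Prop :=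
  ∀ p ∈ R, ∑ i, p.1 i • b x i = p.2

open Classical in
/-- Joint typicality decoding: return the unique sequence that is consistent with the packets
in `R` and jointly typical with the side information `y`; fail if there is none or more than
one. -/
def decode {𝒲 : Type*} [Fintype 𝒲] (μ : PMF (𝒳 × 𝒲)) (η : ℝ) {l n m : ℕ}
    (b : (Fin l → 𝒳) → Fin n → Fin m → F) (R : Finset (Packet F n m)) (y : Fin l → 𝒲) :
    Option (Fin l → 𝒳) :=
  if h : ∃! x : Fin l → 𝒳, Consistent b R x ∧ JointlyTypical μ η x y then some h.choose else none

variable {𝒴 : V → Type*} [∀ v, Fintype (𝒴 v)]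

/-- Joint law of the source `X` and the side information `Y_v`. -/
def pairLaw (P : PMF (𝒳 × ∀ v, 𝒴 v)) (v : V) : PMF (𝒳 × 𝒴 v) := P.map fun z => (z.1, z.2 v)

/-- Law of the source `X`. -/
def sourceLaw (P : PMF (𝒳 × ∀ v, 𝒴 v)) : PMF 𝒳 := P.map Prod.fst

/-- Law of everything random, up to round `t`: the `l` samples of the source and the side
information, the assignment of bins to the sequences, and the coefficient vectors of the packets
stored at the nodes after `t` rounds. Samples, bins, the network, and the coefficients of the
random linear combinations are independent. -/
def experiment (M : ObliviousModel V) (P : PMF (𝒳 × ∀ v, 𝒴 v)) (src : Finset V)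
    (l N n t : ℕ) [NeZero N] :
    PMF ((Fin l → 𝒳 × ∀ v, 𝒴 v) × ((Fin l → 𝒳) → Fin N) × (V → Finset (Fin n → F))) :=
  (indep fun _ : Fin l => P).bind fun z =>
    (PMF.uniformOfFintype ((Fin l → 𝒳) → Fin N)).bind fun bin =>
      (M.history t).bind fun h => (gossip src n h).map fun L => (z, bin, L)

/-- Probability that node `v` correctly decodes the message after `t` rounds. The message `x` is
given to the nodes in `src`, the bin indices are written as vectors over `F` by means of `label`,
blocks consist of `m` symbols, and `η` is the slack of the joint typicality decoder. -/
def decodingProb (M : ObliviousModel V) (P : PMF (𝒳 × ∀ v, 𝒴 v)) (src : Finset V) (δ η : ℝ)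
    (l m : ℕ)
    (label : Fin (numBins (sourceLaw P) δ l) ↪
      (Fin (numSymbols (sourceLaw P) δ l (Fintype.card F)) → F))
    (v : V) (t : ℕ) : ℝ :=
  prob (experiment (F := F) M P src l (numBins (sourceLaw P) δ l)
      (numBlocks (numSymbols (sourceLaw P) δ l (Fintype.card F)) m) t)
    {ω | let x : Fin l → 𝒳 := fun i => (ω.1 i).1
         let y : Fin l → 𝒴 v := fun i => (ω.1 i).2 v
         let b : (Fin l → 𝒳) → _ := fun x' => blocks m (label (ω.2.1 x'))
         decode (pairLaw P v) η b ((ω.2.2 v).image (mkPacket (b x))) y = some x}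

end Decoding

end Gossip

end

namespace Gossip

/-! ### Probability mass functions -/

/-! Fix a nonzero `d` in `F^n` and call a node aware of `d` if it stores a coefficient vector not
orthogonal to `d`. A random combination sent by an aware node has a uniformly distributed product
with `d`, so it makes the receiver aware with probability `1 - 1/q`, independently over the edges.
Hence the aware set evolves exactly like flooding with edge loss `1/q` started at the sources
(`map_aware_gossip`), and after `t` rounds `v` is unaware of `d` with probability below `q^(-α(t -
T))`, for `t > T` (`orthogonal_le_floodTail`).

Put `A = (l/s)(H(X|Y_v) + δ)`. Markov's inequality over the at most `q^n` vectors `d` shows that,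
except with probability `ε/2`, the space `orth` of vectors orthogonal to everything received at `v`
is trivial or has fewer than `q^(n-1-A)` elements (`many_orth_le`). Bin indices consistent with the
packets differ from the true one, symbol position by symbol position, by elements of `orth`, so at
most `|orth|^m` of them remain (`card_consistent_le`).

Coefficient vectors do not depend on the bins, so the bins may be drawn last. A wrong sequence then
survives with probability at most `|orth|^m / N`, where `N` is the number of bins, and a union bound
over the at most `2^(l(H(X|Y_v) + δ/2))` sequences jointly typical with `y_v` gives `2^(-lδ/2)`
(`union_bound_le`). If `orth` is trivial, the count of typical `x` replaces the conditional count.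
It remains that the sample itself is jointly typical, which is Chebyshev's inequality for the
log-probabilities (`not_typical_le`). -/

theorem outerMeasure_le_one {α : Type*} (μ : PMF α) (A : Set α) : μ.toOuterMeasure A ≤ 1 := by
  rw [PMF.toOuterMeasure_apply, ← μ.tsum_coe]
  exact ENNReal.tsum_le_tsum fun a => Set.indicator_le_self _ _ _

theorem outerMeasure_ne_top {α : Type*} (μ : PMF α) (A : Set α) : μ.toOuterMeasure A ≠ ⊤ :=
  ((outerMeasure_le_one μ A).trans_lt ENNReal.one_lt_top).ne

theorem prob_nonneg {α : Type*} (μ : PMF α) (A : Set α) : 0 ≤ prob μ A := ENNReal.toReal_nonneg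

theorem one_sub_le_prob {α : Type*} (μ : PMF α) (A : Set α) {ε : ℝ} (hε : 0 ≤ ε)
    (h : μ.toOuterMeasure Aᶜ ≤ ENNReal.ofReal ε) : 1 - ε ≤ prob μ A := by
  have h1 : (1 : ℝ≥0∞) ≤ μ.toOuterMeasure A + μ.toOuterMeasure Aᶜ := by
    rw [PMF.toOuterMeasure_apply, PMF.toOuterMeasure_apply, ← ENNReal.tsum_add, ← μ.tsum_coe]
    refine ENNReal.tsum_le_tsum fun a => ?_
    by_cases ha : a ∈ A <;> simp [ha]
  have h2 := ENNReal.toReal_mono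
    (ENNReal.add_ne_top.2 ⟨outerMeasure_ne_top _ _, outerMeasure_ne_top _ _⟩) h1
  rw [ENNReal.toReal_add (outerMeasure_ne_top _ _) (outerMeasure_ne_top _ _),
    ENNReal.toReal_one] at h2
  have h3 := ENNReal.toReal_le_of_le_ofReal hε h
  rw [prob]
  linarith

/-- If outside the event `B` the conditional probability of `S` is at most `c`, then `S` has
probability at most `P[B] + c`. -/
theorem outerMeasure_bind_le {α β : Type*} (μ : PMF α) (f : α → PMF β) (S : Set β) (B : Set α)
    (c : ℝ≥0∞) (h : ∀ a ∉ B, (f a).toOuterMeasure S ≤ c) :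
    (μ.bind f).toOuterMeasure S ≤ μ.toOuterMeasure B + c := by
  have h1 : c = ∑' a, μ a * c := by rw [ENNReal.tsum_mul_right, μ.tsum_coe, one_mul]
  rw [PMF.toOuterMeasure_bind_apply, PMF.toOuterMeasure_apply, h1, ← ENNReal.tsum_add]
  refine ENNReal.tsum_le_tsum fun a => ?_
  by_cases ha : a ∈ B
  · rw [Set.indicator_of_mem ha]
    exact (mul_le_of_le_one_right' (outerMeasure_le_one _ _)).trans le_self_add
  · exact (mul_le_mul_right (h a ha) _).trans le_add_self

theorem indep_apply {ι α : Type*} [Fintype ι] [DecidableEq ι] [Fintype α] (p : ι → PMF α)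
    (z : ι → α) : indep p z = ∏ i, p i (z i) := rfl

theorem map_indep {ι α β : Type*} [Fintype ι] [DecidableEq ι] [Fintype α] [Fintype β]
    (p : ι → PMF α) (f : ι → α → β) :
    (indep p).map (fun z i => f i (z i)) = indep fun i => (p i).map (f i) := by
  classical
  ext w
  rw [PMF.map_apply, indep_apply, tsum_fintype]
  simp_rw [PMF.map_apply, tsum_fintype]
  rw [Finset.prod_univ_sum, Fintype.piFinset_univ]
  refine Finset.sum_congr rfl fun z _ => ?_
  rw [Fintype.prod_ite_zero]
  simp only [funext_iff, indep_apply]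

theorem uniformOfFintype_pi {ι α : Type*} [Fintype ι] [DecidableEq ι] [Fintype α] [Nonempty α] :
    PMF.uniformOfFintype (ι → α) = indep fun _ => PMF.uniformOfFintype α := by
  ext z
  simp [indep_apply, ENNReal.inv_pow]

theorem eq_uniformOfFintype {α : Type*} [Fintype α] [Nonempty α] (μ : PMF α)
    (h : ∀ a b, μ a = μ b) : μ = PMF.uniformOfFintype α := by
  ext a
  have h1 := μ.tsum_coe
  rw [tsum_fintype, Finset.sum_congr rfl fun b _ => h b a, Finset.sum_const, Finset.card_univ,
    nsmul_eq_mul] at h1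
  rw [PMF.uniformOfFintype_apply]
  exact ENNReal.eq_inv_of_mul_eq_one_left (by rwa [mul_comm])

theorem bool_pmf_ext {μ ν : PMF Bool} (h : μ false = ν false) : μ = ν := by
  have h1 := μ.tsum_coe
  have h2 := ν.tsum_coe
  rw [tsum_bool] at h1 h2
  ext b
  cases b
  · exact h
  · rw [h] at h1
    exact (ENNReal.add_right_inj (ν.apply_ne_top false)).1 (h1.trans h2.symm)

/-- Shifting `a` in one coordinate where `w` is nonzero is a bijection between the fibres over any
two values, so all values are equally likely. -/
theorem map_sum_mul_uniform {κ F : Type*} [Fintype κ] [DecidableEq κ] [Field F] [Fintype F]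
    (w : κ → F) (hw : w ≠ 0) :
    (PMF.uniformOfFintype (κ → F)).map (fun a => ∑ c, a c * w c) = PMF.uniformOfFintype F := by
  classical
  obtain ⟨c₀, hc⟩ := Function.ne_iff.1 hw
  refine eq_uniformOfFintype _ fun y y' => ?_
  rw [PMF.map_apply, PMF.map_apply, tsum_fintype, tsum_fintype]
  refine Fintype.sum_equiv (Equiv.addRight (Pi.single c₀ ((y' - y) / w c₀))) _ _ fun a => ?_
  have h : ∑ c, (a + (Pi.single c₀ ((y' - y) / w c₀) : κ → F)) c * w c =
      (∑ c, a c * w c) + (y' - y) := by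
    simp only [Pi.add_apply, add_mul, Finset.sum_add_distrib]
    congr 1
    rw [Finset.sum_eq_single c₀ (fun c _ h => by simp [h]) (by simp)]
    simpa using div_mul_cancel₀ _ hc
  simp only [Equiv.coe_addRight, h, PMF.uniformOfFintype_apply]
  congr 1
  rw [eq_iff_iff]
  constructor
  · rintro rfl; ring
  · intro h'; linear_combination h'

theorem map_uniform_ne_zero {F : Type*} [Field F] [Fintype F] [DecidableEq F] :
    (PMF.uniformOfFintype F).map (fun y => decide (y ≠ 0)) =
      coin ((Fintype.card F : ℝ≥0)⁻¹) := by
  refine bool_pmf_ext ?_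
  have hq : (Fintype.card F : ℝ≥0) ≠ 0 := by simp
  have h1 : ((Fintype.card F : ℝ≥0)⁻¹) ≤ 1 :=
    inv_le_one_of_one_le₀ (by exact_mod_cast Fintype.card_pos)
  rw [PMF.map_apply, tsum_fintype]
  simp only [coin, PMF.ofFintype_apply, PMF.uniformOfFintype_apply]
  simp [tsub_tsub_cancel_of_le h1, ENNReal.coe_inv hq]

/-! ### Flooding and random linear network coding -/

section Network

variable {V : Type*} [Fintype V] [DecidableEq V]

theorem subset_informed_cons (S : Finset V) (E : EdgeSet V) (h : List (EdgeSet V)) :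
    informed S h ⊆ informed S (E :: h) := fun v hv => by
  simpa [informed] using ⟨v, hv, Or.inr rfl⟩

theorem informed_subset_of_suffix (S : Finset V) {h h' : List (EdgeSet V)} (hh : h' <:+ h) :
    informed S h' ⊆ informed S h := by
  induction h with
  | nil => rw [List.suffix_nil.1 hh]
  | cons E h ih =>
    rcases List.suffix_cons_iff.1 hh with rfl | h1
    · exact subset_rfl
    · exact (ih h1).trans (subset_informed_cons S E h)

theorem informed_mono {S S' : Finset V} (hS : S ⊆ S') (h : List (EdgeSet V)) :
    informed S h ⊆ informed S' h := by
  induction h with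
  | nil => exact hS
  | cons E h ih =>
    intro v
    simp only [informed, Finset.mem_filter, Finset.mem_univ, true_and]
    rintro ⟨u, hu, h1⟩
    exact ⟨u, ih hu, h1⟩

variable {F : Type*} [Field F] [Fintype F] [DecidableEq F]

/-- The nodes storing a coefficient vector that is not orthogonal to `d`. -/
def aware {n : ℕ} (d : Fin n → F) (L : V → Finset (Fin n → F)) : Finset V :=
  Finset.univ.filter fun v => ∃ c ∈ L v, c ⬝ᵥ d ≠ 0

omit [DecidableEq V] [Fintype F] in
theorem mem_aware {n : ℕ} {d : Fin n → F} {L : V → Finset (Fin n → F)} {v : V} :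
    v ∈ aware d L ↔ ∃ c ∈ L v, c ⬝ᵥ d ≠ 0 := by simp [aware]

/-- Weights expressing the product with `d` of the packet sent along `e` in terms of its random
coefficients; if all vectors stored at the sender are orthogonal to `d`, an arbitrary nonzero
weight is used. -/
def weight {n : ℕ} (d : Fin n → F) (L : V → Finset (Fin n → F)) (e : V × V) (c : Fin n → F) : F :=
  if e.1 ∈ aware d L then (if c ∈ L e.1 then c ⬝ᵥ d else 0) else 1

omit [Fintype F] in
theorem weight_ne_zero {n : ℕ} (d : Fin n → F) (L : V → Finset (Fin n → F)) (e : V × V) :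
    weight d L e ≠ 0 := by
  rw [Function.ne_iff]
  by_cases h : e.1 ∈ aware d L
  · obtain ⟨c, hc, h1⟩ := mem_aware.1 h
    exact ⟨c, by simpa [weight, h, hc] using h1⟩
  · exact ⟨0, by simp [weight, h]⟩

/-- The product of the packet on `e` with `d` plays the role of the coin of `e`: a zero product is a
lost edge. For an unaware sender the coin reads an unrelated combination, which is harmless because
`informed` only looks at edges leaving aware nodes. -/
theorem aware_exchange {n : ℕ} (d : Fin n → F) (E : EdgeSet V) (L : V → Finset (Fin n → F))
    (a : V × V → (Fin n → F) → F) :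
    aware d (exchange E L a) = informed (aware d L)
      [E.filter fun e => decide (∑ c, a e c * weight d L e c ≠ 0) = true] := by
  have key : ∀ u v, (∑ c ∈ L u, a (u, v) c • c) ⬝ᵥ d = ∑ c ∈ L u, a (u, v) c * (c ⬝ᵥ d) := by
    intro u v
    simp [sum_dotProduct, smul_dotProduct]
  have hw : ∀ u v, u ∈ aware d L →
      ∑ c, a (u, v) c * weight d L (u, v) c = ∑ c ∈ L u, a (u, v) c * (c ⬝ᵥ d) := by
    intro u v hu
    simp [weight, hu, Finset.sum_ite_mem]
  ext v
  simp only [informed, mem_aware (L := exchange E L a), Finset.mem_filter, Finset.mem_univ,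
    true_and, decide_eq_true_eq]
  constructor
  · rintro ⟨c, hc, hcd⟩
    rcases Finset.mem_union.1 hc with hc | hc
    · exact ⟨v, mem_aware.2 ⟨c, hc, hcd⟩, Or.inr rfl⟩
    · obtain ⟨u, hu, rfl⟩ := Finset.mem_image.1 hc
      rw [key] at hcd
      have hu' : u ∈ aware d L := by
        obtain ⟨c, hc, h1⟩ := Finset.exists_ne_zero_of_sum_ne_zero hcd
        exact mem_aware.2 ⟨c, hc, right_ne_zero_of_mul h1⟩
      refine ⟨u, hu', Or.inl ⟨(Finset.mem_filter.1 hu).2, ?_⟩⟩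
      rwa [hw u v hu']
  · rintro ⟨u, hu, ⟨hE, h1⟩ | rfl⟩
    · rw [hw u v hu, ← key] at h1
      exact ⟨_, Finset.mem_union_right _
        (Finset.mem_image_of_mem _ (Finset.mem_filter.2 ⟨Finset.mem_univ u, hE⟩)), h1⟩
    · obtain ⟨c, hc, h1⟩ := mem_aware.1 hu
      exact ⟨c, Finset.mem_union_left _ hc, h1⟩

/-- Since every weight vector is nonzero, even at unaware senders, the coins of all edges are i.i.d.
with failure probability `1/q`, whatever the stores are. -/
theorem map_aware_exchange {n : ℕ} (d : Fin n → F) (E : EdgeSet V)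
    (L : V → Finset (Fin n → F)) :
    (PMF.uniformOfFintype (V × V → (Fin n → F) → F)).map (fun a => aware d (exchange E L a)) =
      (thinEdges ((Fintype.card F : ℝ≥0)⁻¹) E).map fun E' => informed (aware d L) [E'] := by
  have h1 : (PMF.uniformOfFintype (V × V → (Fin n → F) → F)).map
      (fun a e => decide (∑ c, a e c * weight d L e c ≠ 0)) =
      indep fun _ : V × V => coin ((Fintype.card F : ℝ≥0)⁻¹) := by
    rw [uniformOfFintype_pi,
      map_indep _ (fun e (b : (Fin n → F) → F) => decide (∑ c, b c * weight d L e c ≠ 0))]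
    congr 1
    funext e
    rw [← map_uniform_ne_zero, ← map_sum_mul_uniform _ (weight_ne_zero d L e), PMF.map_comp]
    rfl
  rw [thinEdges, ← h1, PMF.map_comp, PMF.map_comp]
  congr 1
  funext a
  exact aware_exchange d E L a

/-- For given edge sets, the law of the next aware set depends on the stores only through the
current aware set, and the transition is that of thinned flooding. Initially the aware nodes are
exactly the sources, since one of their unit vectors meets a nonzero coordinate of `d`. -/
theorem map_aware_gossip {n : ℕ} (src : Finset V) (d : Fin n → F) (hd : d ≠ 0)
    (h : List (EdgeSet V)) :
    (gossip src n h).map (aware d) =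
      (thin ((Fintype.card F : ℝ≥0)⁻¹) h).map (informed src) := by
  induction h with
  | nil =>
    simp only [gossip, thin, PMF.pure_map, informed]
    congr 1
    obtain ⟨i, hi⟩ := Function.ne_iff.1 hd
    ext v
    by_cases hv : v ∈ src
    · simp only [mem_aware, initialStore, hv, if_true, iff_true]
      exact ⟨Pi.single i 1, Finset.mem_image_of_mem _ (Finset.mem_univ i), by simpa using hi⟩
    · simp [mem_aware, initialStore, hv]
  | cons E h ih =>
    simp only [gossip, thin, PMF.map_bind, PMF.map_comp]
    have h1 : ∀ S : Finset V, ∀ E' : EdgeSet V, ∀ h',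
        informed src (E' :: h') = informed (informed src h') [E'] := fun _ _ _ => rfl
    have h2 : (gossip src n h).bind (fun L => (thinEdges ((Fintype.card F : ℝ≥0)⁻¹) E).map
          fun E' => informed (aware d L) [E']) =
        ((gossip src n h).map (aware d)).bind fun S =>
          (thinEdges ((Fintype.card F : ℝ≥0)⁻¹) E).map fun E' => informed S [E'] := by
      rw [PMF.bind_map]; rfl
    rw [ih, PMF.bind_map] at h2
    exact (congrArg _ (funext fun L => map_aware_exchange d E L)).trans h2

theorem map_aware_history {n : ℕ} (M : ObliviousModel V) (src : Finset V) (d : Fin n → F)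
    (hd : d ≠ 0) (t : ℕ) :
    ((M.history t).bind (gossip src n)).map (aware d) =
      ((M.history t).bind (thin ((Fintype.card F : ℝ≥0)⁻¹))).map (informed src) := by
  rw [PMF.map_bind, PMF.map_bind]
  exact congrArg _ (funext fun h => map_aware_gossip src d hd h)

/-- After `t` rounds the vectors stored at `v` are all orthogonal to a given `d ≠ 0` with
probability at most the tail of the flooding time. -/
theorem orthogonal_le_floodTail {n : ℕ} (M : ObliviousModel V) (src : Finset V) (u : V)
    (hu : u ∈ src) (d : Fin n → F) (hd : d ≠ 0) (v : V) (t : ℕ) :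
    ((M.history t).bind (gossip src n)).toOuterMeasure {L | ∀ c ∈ L v, c ⬝ᵥ d = 0} ≤
      ENNReal.ofReal (floodTail M ((Fintype.card F : ℝ≥0)⁻¹) {u} t) := by
  have h1 : {L : V → Finset (Fin n → F) | ∀ c ∈ L v, c ⬝ᵥ d = 0} =
      aware d ⁻¹' {S | v ∉ S} := by
    ext L
    simp [mem_aware]
  rw [h1, ← PMF.toOuterMeasure_map_apply, map_aware_history M src d hd t,
    PMF.toOuterMeasure_map_apply, floodTail, prob,
    ENNReal.ofReal_toReal (outerMeasure_ne_top _ _), Nat.ceil_natCast]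
  -- If `v` is not informed by the end, no initial segment has informed all nodes, so the condition
  -- defining the tail holds vacuously.
  refine MeasureTheory.measure_mono fun L hL L' hL' hinf => ?_
  refine absurd ?_ hL
  exact informed_mono (Finset.singleton_subset_iff.2 hu) L
    (informed_subset_of_suffix {u} hL' (hinf ▸ Finset.mem_univ v))

end Network

/-! ### Entropy and typical sequences -/

section Typicality

open MeasureTheory ProbabilityTheory

theorem toReal_apply_le_one {α : Type*} (μ : PMF α) (a : α) : (μ a).toReal ≤ 1 :=
  ENNReal.toReal_le_of_le_ofReal zero_le_one (by simpa using μ.coe_le_one a)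

theorem sum_toReal {α : Type*} [Fintype α] (μ : PMF α) : ∑ a, (μ a).toReal = 1 := by
  rw [← ENNReal.toReal_sum fun a _ => μ.apply_ne_top a, ← tsum_fintype (L := .unconditional _),
    μ.tsum_coe, ENNReal.toReal_one]

theorem entropy_nonneg {α : Type*} [Fintype α] (μ : PMF α) : 0 ≤ entropy μ := by
  rw [entropy, neg_nonneg]
  exact Finset.sum_nonpos fun a _ => mul_nonpos_of_nonneg_of_nonpos ENNReal.toReal_nonneg
    (Real.logb_nonpos one_lt_two ENNReal.toReal_nonneg (toReal_apply_le_one μ a))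

theorem map_snd_toReal {α β : Type*} [Fintype α] [Fintype β] (μ : PMF (α × β)) (b : β) :
    (μ.map Prod.snd b).toReal = ∑ a, (μ (a, b)).toReal := by
  classical
  rw [← ENNReal.toReal_sum fun a _ => μ.apply_ne_top _, PMF.map_apply, tsum_fintype,
    Fintype.sum_prod_type]
  simp

theorem toReal_le_map_snd {α β : Type*} [Fintype α] [Fintype β] (μ : PMF (α × β)) (a : α)
    (b : β) : (μ (a, b)).toReal ≤ (μ.map Prod.snd b).toReal := by
  rw [map_snd_toReal]
  exact Finset.single_le_sum (f := fun a => (μ (a, b)).toReal)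
    (fun _ _ => ENNReal.toReal_nonneg) (Finset.mem_univ a)

theorem condEntropy_nonneg {α β : Type*} [Fintype α] [Fintype β] (μ : PMF (α × β)) :
    0 ≤ condEntropy μ := by
  rw [condEntropy, neg_nonneg]
  refine Finset.sum_nonpos fun a _ => Finset.sum_nonpos fun b _ =>
    mul_nonpos_of_nonneg_of_nonpos ENNReal.toReal_nonneg (Real.logb_nonpos one_lt_two
      (div_nonneg ENNReal.toReal_nonneg ENNReal.toReal_nonneg)
      (div_le_one_of_le₀ (toReal_le_map_snd μ a b) ENNReal.toReal_nonneg))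

theorem condEntropy_eq_sub {α β : Type*} [Fintype α] [Fintype β] (μ : PMF (α × β)) :
    condEntropy μ = entropy μ - entropy (μ.map Prod.snd) := by
  have h1 : ∀ a b, (μ (a, b)).toReal *
      Real.logb 2 ((μ (a, b)).toReal / (μ.map Prod.snd b).toReal) =
      (μ (a, b)).toReal * Real.logb 2 (μ (a, b)).toReal -
        (μ (a, b)).toReal * Real.logb 2 (μ.map Prod.snd b).toReal := by
    intro a b
    -- The logarithm of the quotient splits only for a positive joint probability; otherwise the
    -- factor in front kills all terms.
    rcases eq_or_ne (μ (a, b)).toReal 0 with h | h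
    · simp [h]
    · have h0 : 0 < (μ (a, b)).toReal := lt_of_le_of_ne ENNReal.toReal_nonneg h.symm
      rw [Real.logb_div h (h0.trans_le (toReal_le_map_snd μ a b)).ne', mul_sub]
  have h2 : ∑ b, (μ.map Prod.snd b).toReal * Real.logb 2 (μ.map Prod.snd b).toReal =
      ∑ a, ∑ b, (μ (a, b)).toReal * Real.logb 2 (μ.map Prod.snd b).toReal := by
    rw [Finset.sum_comm]
    exact Finset.sum_congr rfl fun b _ => by
      rw [← Finset.sum_mul, ← map_snd_toReal]
  rw [condEntropy, entropy, entropy, h2, Fintype.sum_prod_type]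
  simp only [h1, Finset.sum_sub_distrib]
  ring

open Classical in
theorem card_typical_le {α : Type*} [Fintype α] (μ : PMF α) (η : ℝ) (l : ℕ) :
    ((Finset.univ.filter fun x : Fin l → α => Typical μ η x).card : ℝ) ≤
      (2 : ℝ) ^ (l * (entropy μ + η)) := by
  have h1 : ∑ x : Fin l → α, ∏ i, (μ (x i)).toReal = 1 := by
    rw [← Fintype.piFinset_univ,
      ← Finset.prod_univ_sum (fun _ : Fin l => Finset.univ) fun _ a => (μ a).toReal]
    simp [sum_toReal]
  have h2 : ((Finset.univ.filter fun x : Fin l → α => Typical μ η x).card : ℝ) *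
      (2 : ℝ) ^ (-(l * (entropy μ + η))) ≤ 1 := by
    rw [← h1, ← nsmul_eq_mul, ← Finset.sum_const]
    exact (Finset.sum_le_sum fun x hx => (Finset.mem_filter.1 hx).2.1).trans
      (Finset.sum_le_sum_of_subset_of_nonneg (Finset.subset_univ _) fun x _ _ =>
        Finset.prod_nonneg fun i _ => ENNReal.toReal_nonneg)
  rw [Real.rpow_neg two_pos.le, ← div_eq_mul_inv,
    div_le_one (Real.rpow_pos_of_pos two_pos _)] at h2
  exact h2

open Classical in
-- The joint probabilities over all `x` add up to the probability of `y`, which typicality bounds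
-- above, while each jointly typical `x` contributes at least `2^(-l(H(X,Y) + η))`. The quotient has
-- exponent `H(X,Y) - H(Y) + 2η`.
theorem card_jointlyTypical_le {α β : Type*} [Fintype α] [Fintype β] (μ : PMF (α × β)) (η : ℝ)
    {l : ℕ} (y : Fin l → β) :
    ((Finset.univ.filter fun x : Fin l → α => JointlyTypical μ η x y).card : ℝ) ≤
      (2 : ℝ) ^ (l * (condEntropy μ + 2 * η)) := by
  -- `y` is arbitrary; its typicality is read off from a member of the set, if there is one.
  rcases (Finset.univ.filter fun x : Fin l → α => JointlyTypical μ η x y).eq_empty_or_nonempty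
    with h0 | ⟨x₀, hx₀⟩
  · rw [h0, Finset.card_empty, Nat.cast_zero]
    positivity
  have hy : Typical (μ.map Prod.snd) η y := (Finset.mem_filter.1 hx₀).2.2.1
  have h1 : ∑ x : Fin l → α, ∏ i, (μ (x i, y i)).toReal = ∏ i, (μ.map Prod.snd (y i)).toReal := by
    simp_rw [map_snd_toReal]
    rw [Finset.prod_univ_sum, Fintype.piFinset_univ]
  have h2 : ((Finset.univ.filter fun x : Fin l → α => JointlyTypical μ η x y).card : ℝ) *
      (2 : ℝ) ^ (-(l * (entropy μ + η))) ≤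
        (2 : ℝ) ^ (-(l * (entropy (μ.map Prod.snd) - η))) := by
    refine le_trans ?_ hy.2
    rw [← h1, ← nsmul_eq_mul, ← Finset.sum_const]
    exact (Finset.sum_le_sum fun x hx => (Finset.mem_filter.1 hx).2.2.2.1).trans
      (Finset.sum_le_sum_of_subset_of_nonneg (Finset.subset_univ _) fun x _ _ =>
        Finset.prod_nonneg fun i _ => ENNReal.toReal_nonneg)
  rw [Real.rpow_neg two_pos.le, ← div_eq_mul_inv,
    div_le_iff₀ (Real.rpow_pos_of_pos two_pos _), ← Real.rpow_add two_pos] at h2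
  refine h2.trans (le_of_eq ?_)
  rw [condEntropy_eq_sub]
  congr 1
  ring

theorem toMeasure_indep {ι α : Type*} [Fintype ι] [DecidableEq ι] [Fintype α]
    [MeasurableSpace α] [MeasurableSingletonClass α] (p : ι → PMF α) :
    (indep p).toMeasure = Measure.pi fun i => (p i).toMeasure := by
  refine Measure.ext_of_singleton fun z => ?_
  rw [PMF.toMeasure_apply_singleton _ _ (measurableSet_singleton z), Measure.pi_singleton]
  exact Finset.prod_congr rfl fun i _ =>
    (PMF.toMeasure_apply_singleton _ _ (measurableSet_singleton _)).symm

theorem prod_eq_rpow_sum_logb {α : Type*} [Fintype α] (μ : PMF α) {l : ℕ} (x : Fin l → α)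
    (hx : ∀ i, μ (x i) ≠ 0) :
    ∏ i, (μ (x i)).toReal = (2 : ℝ) ^ ∑ i, Real.logb 2 (μ (x i)).toReal := by
  rw [Real.rpow_sum_of_pos two_pos]
  exact Finset.prod_congr rfl fun i _ => (Real.rpow_logb two_pos (by norm_num)
    (ENNReal.toReal_pos (hx i) (μ.apply_ne_top _))).symm

/-- Chebyshev's inequality for the sum of the i.i.d. variables `log μ(x i)`, of mean `-H` each; `C`
is the variance of one of them. -/
theorem not_typical_le {α : Type*} [Fintype α] (μ : PMF α) :
    ∃ C : ℝ, ∀ η : ℝ, 0 < η → ∀ l : ℕ, 0 < l →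
      (indep fun _ : Fin l => μ).toOuterMeasure {x | ¬Typical μ η x} ≤
        ENNReal.ofReal (C / (l * η ^ 2)) := by
  let _ : MeasurableSpace α := ⊤
  set X : α → ℝ := fun a => Real.logb 2 (μ a).toReal with hX
  refine ⟨Var[X; μ.toMeasure], fun η hη l hl => ?_⟩
  have hl' : (0 : ℝ) < l := by exact_mod_cast hl
  have hmem : MemLp X 2 μ.toMeasure := MemLp.of_discrete
  have hmean : ∫ ω, (∑ i, fun ω : Fin l → α => X (ω i)) ω ∂(Measure.pi fun _ => μ.toMeasure) =
      -(l * entropy μ) := by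
    simp only [Finset.sum_apply]
    rw [integral_finsetSum _ fun i _ => Integrable.of_finite]
    have : ∀ i : Fin l, ∫ ω : Fin l → α, X (ω i) ∂(Measure.pi fun _ => μ.toMeasure) =
        -entropy μ := by
      intro i
      have hi := measurePreserving_eval (fun _ : Fin l => μ.toMeasure) i
      have h1 := integral_map (μ := Measure.pi fun _ : Fin l => μ.toMeasure)
        hi.measurable.aemeasurable (f := X) (Measurable.of_discrete.aestronglyMeasurable)
      rw [hi.map_eq] at h1
      refine h1.symm.trans ?_
      rw [PMF.integral_eq_sum]
      simp [entropy, hX]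
    simp [this]
  have hvar := variance_sum_pi (μ := fun _ : Fin l => μ.toMeasure) (X := fun _ => X)
    fun _ => hmem
  have hcheb := meas_ge_le_variance_div_sq (μ := Measure.pi fun _ : Fin l => μ.toMeasure)
    (X := ∑ i, fun ω : Fin l → α => X (ω i)) MemLp.of_discrete (c := l * η) (by positivity)
  rw [hvar, hmean, ← toMeasure_indep, PMF.toMeasure_apply_eq_toOuterMeasure] at hcheb
  refine le_trans (PMF.toOuterMeasure_mono _ ?_) (hcheb.trans (le_of_eq ?_))
  -- Only sequences in the support matter. Elsewhere some `μ (x i)` is zero, and the convention `log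
  -- 0 = 0` would make the sum of logarithms disagree with the product.
  · rintro x ⟨hx, hsupp⟩
    rw [PMF.mem_support_iff, indep_apply] at hsupp
    have hpos : ∀ i, μ (x i) ≠ 0 := fun i h =>
      hsupp (Finset.prod_eq_zero (Finset.mem_univ i) h)
    simp only [Set.mem_ofPred_eq, Typical, prod_eq_rpow_sum_logb μ x hpos,
      Real.rpow_le_rpow_left_iff one_lt_two] at hx
    simp only [Set.mem_ofPred_eq, Finset.sum_apply, hX]
    by_contra hc
    rw [not_le, abs_lt] at hc
    exact hx ⟨by linarith [hc.1], by linarith [hc.2]⟩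
  · congr 1
    simp only [Finset.sum_const, Finset.card_univ, Fintype.card_fin, nsmul_eq_mul]
    field_simp

/-- Weak law for the typical sequences of an image law. -/
theorem eventually_typical {β α : Type*} [Fintype β] [Fintype α] (P : PMF β) (g : β → α) {η : ℝ}
    (hη : 0 < η) {ε : ℝ} (hε : 0 < ε) :
    ∃ l₀ : ℕ, ∀ l : ℕ, l₀ ≤ l →
      (indep fun _ : Fin l => P).toOuterMeasure {z | ¬Typical (P.map g) η fun i => g (z i)} ≤
        ENNReal.ofReal ε := by
  obtain ⟨C, hC⟩ := not_typical_le (P.map g)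
  obtain ⟨l₀, hl₀⟩ := exists_nat_gt (C / (ε * η ^ 2))
  refine ⟨l₀ + 1, fun l hl => ?_⟩
  have hl1 : 0 < l := by omega
  have hl2 : (l₀ : ℝ) ≤ l := by exact_mod_cast (by omega : l₀ ≤ l)
  have hl3 : (0 : ℝ) < l := by exact_mod_cast hl1
  have h1 : {z : Fin l → β | ¬Typical (P.map g) η fun i => g (z i)} =
      (fun z i => g (z i)) ⁻¹' {x | ¬Typical (P.map g) η x} := rfl
  rw [h1, ← PMF.toOuterMeasure_map_apply, map_indep (fun _ : Fin l => P) fun _ => g]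
  refine (hC η hη l hl1).trans (ENNReal.ofReal_le_ofReal ?_)
  rw [div_le_iff₀ (by positivity)]
  have h2 := (div_lt_iff₀ (by positivity)).1 hl₀
  nlinarith [mul_le_mul_of_nonneg_right hl2 (by positivity : 0 ≤ ε * η ^ 2)]

theorem eventually_jointlyTypical {β α γ : Type*} [Fintype β] [Fintype α] [Fintype γ]
    (P : PMF β) (g : β → α × γ) {η : ℝ} (hη : 0 < η) {ε : ℝ} (hε : 0 < ε) :
    ∃ l₀ : ℕ, ∀ l : ℕ, l₀ ≤ l →
      (indep fun _ : Fin l => P).toOuterMeasure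
        {z | ¬JointlyTypical (P.map g) η (fun i => (g (z i)).1) fun i => (g (z i)).2} ≤
        ENNReal.ofReal ε := by
  obtain ⟨l₁, h₁⟩ := eventually_typical P (fun b => (g b).1) hη (ε := ε / 3) (by positivity)
  obtain ⟨l₂, h₂⟩ := eventually_typical P (fun b => (g b).2) hη (ε := ε / 3) (by positivity)
  obtain ⟨l₃, h₃⟩ := eventually_typical P g hη (ε := ε / 3) (by positivity)
  refine ⟨max l₁ (max l₂ l₃), fun l hl => ?_⟩
  simp only [max_le_iff] at hl
  have hε3 : ENNReal.ofReal ε =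
      ENNReal.ofReal (ε / 3) + ENNReal.ofReal (ε / 3) + ENNReal.ofReal (ε / 3) := by
    rw [← ENNReal.ofReal_add (by positivity) (by positivity),
      ← ENNReal.ofReal_add (by positivity) (by positivity)]
    congr 1
    ring
  rw [hε3]
  refine le_trans (measure_mono ?_) ((measure_union_le _ _).trans (add_le_add
    ((measure_union_le _ _).trans (add_le_add (h₁ l hl.1) (h₂ l hl.2.1))) (h₃ l hl.2.2)))
  intro z hz
  by_contra hc
  simp only [Set.mem_union, Set.mem_ofPred_eq, not_or, not_not] at hc
  refine hz ⟨?_, ?_, hc.2⟩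
  · rw [PMF.map_comp]; exact hc.1.1
  · rw [PMF.map_comp]; exact hc.1.2

end Typicality

/-! ### Solutions of the received equations -/

section Orthogonal

variable {F : Type*} [Field F] [Fintype F] [DecidableEq F]

/-- The vectors orthogonal to all vectors in `R`. -/
def orth {n : ℕ} (R : Finset (Fin n → F)) : Finset (Fin n → F) :=
  Finset.univ.filter fun d => ∀ c ∈ R, c ⬝ᵥ d = 0

theorem mem_orth {n : ℕ} {R : Finset (Fin n → F)} {d : Fin n → F} :
    d ∈ orth R ↔ ∀ c ∈ R, c ⬝ᵥ d = 0 := by simp [orth]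

theorem zero_mem_orth {n : ℕ} (R : Finset (Fin n → F)) : (0 : Fin n → F) ∈ orth R := by
  simp [mem_orth]

/-- If every nonzero vector is orthogonal to all packets at `v` with probability at most `p`,
then there are at least `K` (and a nonzero one) such vectors with probability at most
`2 q ^ n p / K`. -/
theorem card_orth_markov {V : Type*} [Fintype V] [DecidableEq V] {n : ℕ}
    (ν : PMF (V → Finset (Fin n → F))) (v : V) (p K : ℝ≥0∞)
    (h : ∀ d : Fin n → F, d ≠ 0 → ν.toOuterMeasure {L | ∀ c ∈ L v, c ⬝ᵥ d = 0} ≤ p) :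
    ν.toOuterMeasure {L | 1 < (orth (L v)).card ∧ K ≤ (orth (L v)).card} * K ≤
      2 * (Fintype.card F ^ n * p) := by
  have h1 : ∑ d ∈ Finset.univ.erase (0 : Fin n → F),
      ν.toOuterMeasure {L | ∀ c ∈ L v, c ⬝ᵥ d = 0} ≤ Fintype.card F ^ n * p := by
    refine (Finset.sum_le_sum fun d hd => h d (Finset.ne_of_mem_erase hd)).trans ?_
    rw [Finset.sum_const, nsmul_eq_mul]
    refine mul_le_mul_left (α := ℝ≥0∞) ?_ p
    have : (Finset.univ.erase (0 : Fin n → F)).card ≤ Fintype.card F ^ n := by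
      refine (Finset.card_le_univ _).trans (le_of_eq ?_)
      simp
    exact_mod_cast this
  -- Markov's inequality by hand: exchange the sums over `d` and `L`, then compare for each `L` the
  -- value `K` with twice the number of nonzero vectors in `orth (L v)`.
  refine le_trans ?_ (mul_le_mul_right h1 2)
  simp only [PMF.toOuterMeasure_apply_fintype]
  rw [Finset.sum_comm, Finset.sum_mul, Finset.mul_sum]
  refine Finset.sum_le_sum fun L _ => ?_
  by_cases hL : L ∈ {L : V → Finset (Fin n → F) |
      1 < (orth (L v)).card ∧ K ≤ (orth (L v)).card}
  · rw [Set.indicator_of_mem hL]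
    have h2 : ∑ d ∈ Finset.univ.erase (0 : Fin n → F),
        Set.indicator {L : V → Finset (Fin n → F) | ∀ c ∈ L v, c ⬝ᵥ d = 0} (⇑ν) L =
        ((orth (L v)).erase 0).card * ν L := by
      have h3 : (orth (L v)).erase 0 =
          (Finset.univ.erase (0 : Fin n → F)).filter fun d => ∀ c ∈ L v, c ⬝ᵥ d = 0 := by
        ext d
        simp [mem_orth]
      rw [h3, ← nsmul_eq_mul, ← Finset.sum_const, Finset.sum_filter]
      exact Finset.sum_congr rfl fun d _ => by simp [Set.indicator_apply]
    -- Dropping the zero vector from a set of at least two elements at most halves it; this is the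
    -- factor 2 in the bound.
    have h4 : (orth (L v)).card ≤ 2 * ((orth (L v)).erase 0).card := by
      rw [Finset.card_erase_of_mem (zero_mem_orth _)]
      have := hL.1
      omega
    have h5 : K ≤ 2 * (((orth (L v)).erase 0).card : ℝ≥0∞) := hL.2.trans (by exact_mod_cast h4)
    rw [h2, ← mul_assoc, mul_comm (ν L)]
    exact mul_le_mul_left h5 _
  · rw [Set.indicator_of_notMem hL, zero_mul]
    exact zero_le

omit [Fintype F] [DecidableEq F] in
theorem blocks_injective {h m : ℕ} (hm : 0 < m) :
    Function.Injective (blocks m : (Fin h → F) → Fin (numBlocks h m) → Fin m → F) := by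
  intro w w' hw
  funext k
  have hk : k.1 / m < numBlocks h m := by
    rw [numBlocks, Nat.lt_ceil]
    refine Nat.cast_div_le.trans_lt ?_
    have : (k.1 : ℝ) < h := by exact_mod_cast k.2
    gcongr
  have h1 := congrFun (congrFun hw ⟨k.1 / m, hk⟩) ⟨k.1 % m, Nat.mod_lt _ hm⟩
  have h2 : k.1 / m * m + k.1 % m = k.1 := Nat.div_add_mod' _ _
  simpa [blocks, h2] using h1

/-- The payload equations decouple over the `m` symbol positions: for each of them the difference of
the two block arrays is a vector in `orth R`. An index is recovered from its `m` differences because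
`b` is injective. -/
theorem card_consistent_le {ι : Type*} [Fintype ι] {n m : ℕ} (b : ι → Fin n → Fin m → F)
    (hb : Function.Injective b) (R : Finset (Fin n → F)) (a : ι) :
    (Finset.univ.filter fun a' =>
      ∀ c ∈ R, ∑ i, c i • b a' i = ∑ i, c i • b a i).card ≤ (orth R).card ^ m := by
  have h1 : (Fintype.piFinset fun _ : Fin m => orth R).card = (orth R).card ^ m := by simp
  rw [← h1]
  refine Finset.card_le_card_of_injOn (fun a' j i => b a' i j - b a i j) ?_ ?_
  · intro a' ha'
    rw [Finset.mem_coe, Finset.mem_filter] at ha'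
    rw [Finset.mem_coe, Fintype.mem_piFinset]
    intro j
    rw [mem_orth]
    intro c hc
    have h2 := congrFun (ha'.2 c hc) j
    simp only [Finset.sum_apply, Pi.smul_apply, smul_eq_mul] at h2
    simp only [dotProduct, mul_sub, Finset.sum_sub_distrib, h2, sub_self]
  · intro a₁ _ a₂ _ h12
    refine hb (funext fun i => funext fun j => ?_)
    have h2 := congrFun (congrFun h12 j) i
    exact sub_left_injective h2

end Orthogonal

/-! ### Random binning -/

/-- Once the bins of all sequences other than `x'` are fixed, at most `k` of the `N` choices for
`x'` are bad. -/
theorem uniform_pair_le {A : Type*} [Fintype A] [DecidableEq A] (N : ℕ) [NeZero N]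
    (R : Fin N → Fin N → Prop) [∀ a, DecidablePred (R a)] (k : ℕ)
    (hk : ∀ a, (Finset.univ.filter fun b => R a b).card ≤ k) {x x' : A} (hne : x' ≠ x) :
    (PMF.uniformOfFintype (A → Fin N)).toOuterMeasure {f | R (f x) (f x')} ≤
      (k : ℝ≥0∞) / N := by
  set S : Finset (A → Fin N) := Finset.univ.filter fun f => R (f x) (f x') with hS
  have hN : (N : ℝ≥0∞) ≠ 0 := by exact_mod_cast NeZero.ne N
  have h1 : S.card ≤ k * N ^ (Fintype.card A - 1) := by
    let φ : (A → Fin N) → {y // y ≠ x'} → Fin N := fun f y => f y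
    have h2 : (S.image φ).card ≤ N ^ (Fintype.card A - 1) := by
      refine (Finset.card_le_univ _).trans (le_of_eq ?_)
      simp [Fintype.card_subtype_compl]
    refine (Finset.card_le_mul_card_image S k fun g _ => ?_).trans
      (Nat.mul_le_mul_left k h2)
    refine le_trans (Finset.card_le_card_of_injOn (fun f => f x') (t :=
      Finset.univ.filter fun b => R (g ⟨x, hne.symm⟩) b) ?_ ?_) (hk _)
    · intro f hf
      simp only [Finset.coe_filter, Set.mem_ofPred_eq, hS, Finset.mem_filter, Finset.mem_univ,
        true_and] at hf ⊢
      rw [← hf.2]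
      exact hf.1
    · intro f hf f' hf' hff
      simp only [Finset.coe_filter, Set.mem_ofPred_eq] at hf hf'
      funext y
      by_cases hy : y = x'
      · rw [hy]; exact hff
      · exact congrFun (hf.2.trans hf'.2.symm) ⟨y, hy⟩
  have h3 : Fintype.card A = (Fintype.card A - 1) + 1 :=
    (Nat.sub_add_cancel (Fintype.card_pos_iff.2 ⟨x⟩)).symm
  rw [PMF.toOuterMeasure_uniformOfFintype_apply, Fintype.card_fun, Fintype.card_fin,
    ← Set.toFinset_card, Set.toFinset_ofPred, ← hS]
  have h4 : ((N ^ Fintype.card A : ℕ) : ℝ≥0∞) = N ^ (Fintype.card A - 1) * N := by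
    conv_lhs => rw [h3]
    push_cast
    ring
  rw [h4]
  calc (S.card : ℝ≥0∞) / (N ^ (Fintype.card A - 1) * N)
      ≤ (k * N ^ (Fintype.card A - 1)) / (N ^ (Fintype.card A - 1) * N) :=
        ENNReal.div_le_div_right (by exact_mod_cast h1) _
    _ = k / N := by
        rw [mul_comm (k : ℝ≥0∞)]
        exact ENNReal.mul_div_mul_left _ _ (pow_ne_zero _ hN)
          (ENNReal.pow_ne_top (ENNReal.natCast_ne_top N))

section Decoding

variable {F 𝒳 : Type*} [Field F] [Fintype F] [DecidableEq F] [Fintype 𝒳] [DecidableEq 𝒳]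

omit [Fintype 𝒳] [DecidableEq 𝒳] [Fintype F] in
theorem consistent_image_mkPacket {l n m : ℕ} (b : (Fin l → 𝒳) → Fin n → Fin m → F)
    (R : Finset (Fin n → F)) (x x' : Fin l → 𝒳) :
    Consistent b (R.image (mkPacket (b x))) x' ↔
      ∀ c ∈ R, ∑ i, c i • b x' i = ∑ i, c i • b x i := by
  simp only [Consistent, Finset.forall_mem_image]
  rfl

omit [DecidableEq 𝒳] [Fintype F] in
theorem decode_eq_some {𝒲 : Type*} [Fintype 𝒲] (μ : PMF (𝒳 × 𝒲)) (η : ℝ) {l n m : ℕ}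
    (b : (Fin l → 𝒳) → Fin n → Fin m → F) (R : Finset (Fin n → F)) (x : Fin l → 𝒳)
    (y : Fin l → 𝒲) (hxy : JointlyTypical μ η x y)
    (h : ∀ x', x' ≠ x → JointlyTypical μ η x' y →
      ¬∀ c ∈ R, ∑ i, c i • b x' i = ∑ i, c i • b x i) :
    decode μ η b (R.image (mkPacket (b x))) y = some x := by
  have h1 : Consistent b (R.image (mkPacket (b x))) x ∧ JointlyTypical μ η x y :=
    ⟨(consistent_image_mkPacket b R x x).2 fun _ _ => rfl, hxy⟩
  have h2 : ∃! x' : Fin l → 𝒳,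
      Consistent b (R.image (mkPacket (b x))) x' ∧ JointlyTypical μ η x' y := by
    refine ⟨x, h1, fun x' hx' => ?_⟩
    by_contra hne
    exact h x' hne hx'.2 ((consistent_image_mkPacket b R x x').1 hx'.1)
  rw [decode, dif_pos h2]
  exact congrArg some (h2.unique h2.choose_spec.1 h1)

open Classical in
/-- With the received coefficient vectors and a jointly typical sample fixed, random binning
fails with probability at most the number of jointly typical sequences, times the chance that
one of them satisfies all equations. -/
theorem decode_failure_le {𝒲 : Type*} [Fintype 𝒲] (μ : PMF (𝒳 × 𝒲)) (η : ℝ) {l n m N : ℕ}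
    [NeZero N] (b : Fin N → Fin n → Fin m → F) (hb : Function.Injective b)
    (R : Finset (Fin n → F)) (x : Fin l → 𝒳) (y : Fin l → 𝒲) (hxy : JointlyTypical μ η x y) :
    (PMF.uniformOfFintype ((Fin l → 𝒳) → Fin N)).toOuterMeasure
      {bin | ¬decode μ η (fun x' => b (bin x')) (R.image (mkPacket (b (bin x)))) y = some x} ≤
      (Finset.univ.filter fun x' : Fin l → 𝒳 => JointlyTypical μ η x' y).card *
        (((orth R).card ^ m : ℕ) / (N : ℝ≥0∞)) := by
  have hsub : {bin : (Fin l → 𝒳) → Fin N |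
      ¬decode μ η (fun x' => b (bin x')) (R.image (mkPacket (b (bin x)))) y = some x} ⊆
      ⋃ x' ∈ (Finset.univ.filter fun x' : Fin l → 𝒳 => JointlyTypical μ η x' y).erase x,
        {bin : (Fin l → 𝒳) → Fin N |
          ∀ c ∈ R, ∑ i, c i • b (bin x') i = ∑ i, c i • b (bin x) i} := by
    intro bin hbin
    by_contra hc
    simp only [Set.mem_iUnion, not_exists] at hc
    exact hbin (decode_eq_some μ η (fun x' => b (bin x')) R x y hxy fun x' hne hx' =>
      hc x' (Finset.mem_erase.2 ⟨hne, Finset.mem_filter.2 ⟨Finset.mem_univ _, hx'⟩⟩))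
  refine (MeasureTheory.measure_mono hsub).trans
    ((MeasureTheory.measure_biUnion_finset_le _ _).trans ?_)
  refine (Finset.sum_le_sum fun x' hx' => uniform_pair_le N
    (fun a a' => ∀ c ∈ R, ∑ i, c i • b a' i = ∑ i, c i • b a i) ((orth R).card ^ m)
    (fun a => card_consistent_le b hb R a) (Finset.ne_of_mem_erase hx')).trans ?_
  rw [Finset.sum_const, nsmul_eq_mul]
  refine mul_le_mul_left (α := ℝ≥0∞) ?_ _
  exact_mod_cast Finset.card_erase_le

end Decoding

/-! ### Estimates of the two error terms -/

theorem two_rpow_logb {q : ℝ} (hq : 0 < q) (x : ℝ) : q ^ x = (2 : ℝ) ^ (Real.logb 2 q * x) := by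
  rw [Real.rpow_mul two_pos.le, Real.rpow_logb two_pos (by norm_num) hq]

/-- If the equations leave fewer than `q ^ (n - r)` solutions per symbol, or only one, the union
bound over the jointly typical sequences is at most `2 ^ (-l δ / 2)`. -/
theorem union_bound_le {q : ℕ} (hq : 1 < q) {l m : ℕ} (hm : 0 < m) {H C δ : ℝ} (hH : 0 ≤ H)
    (hδ : 0 < δ) {h n N J k : ℕ} (hh : h = ⌈(l : ℝ) / Real.logb 2 q * (H + δ)⌉₊)
    (hn : n = numBlocks h m) (hN : (2 : ℝ) ^ (l * (H + δ)) ≤ N)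
    (hJ₁ : (J : ℝ) ≤ (2 : ℝ) ^ (l * (H + δ / 4)))
    (hJ₂ : (J : ℝ) ≤ (2 : ℝ) ^ (l * (C + 2 * (δ / 4))))
    (hk : k ≤ 1 ∨
      (k : ℝ) ≤ (q : ℝ) ^ (n - (1 + l / (m * Real.logb 2 q) * (C + δ)))) :
    (J : ℝ) * ((k : ℝ) ^ m / N) ≤ (2 : ℝ) ^ (-(l * (δ / 2))) := by
  have hq0 : (0 : ℝ) < q := by exact_mod_cast (by omega : 0 < q)
  have hq1 : (1 : ℝ) < q := by exact_mod_cast hq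
  have hlog : 0 < Real.logb 2 q := Real.logb_pos one_lt_two hq1
  have hm0 : (0 : ℝ) < m := by exact_mod_cast hm
  have hN0 : (0 : ℝ) < N := (Real.rpow_pos_of_pos two_pos _).trans_le hN
  have hl0 : (0 : ℝ) ≤ l := l.cast_nonneg
  rcases hk with hk | hk
  · have h1 : (k : ℝ) ^ m ≤ 1 := pow_le_one₀ k.cast_nonneg (by exact_mod_cast hk)
    calc (J : ℝ) * ((k : ℝ) ^ m / N)
        ≤ (2 : ℝ) ^ (l * (H + δ / 4)) * (1 / (2 : ℝ) ^ (l * (H + δ))) := by gcongr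
      _ = (2 : ℝ) ^ (l * (H + δ / 4) - l * (H + δ)) := by
          rw [Real.rpow_sub two_pos, mul_one_div]
      _ ≤ (2 : ℝ) ^ (-(l * (δ / 2))) := by
          apply Real.rpow_le_rpow_of_exponent_le one_le_two
          nlinarith [mul_nonneg hl0 hδ.le]
  · have hh1 : (h : ℝ) - 1 ≤ l / Real.logb 2 q * (H + δ) := by
      have := Nat.ceil_lt_add_one (a := (l : ℝ) / Real.logb 2 q * (H + δ)) (by positivity)
      rw [← hh] at this
      linarith
    -- Integrality sharpens the strict ceiling bound by one. Hence `(n - 1) m ≤ h - 1 ≤ (l / log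
    -- q)(H + δ)`: giving up a single block, the `1` in `1 + A`, pays for both roundings.
    have hn1 : (n : ℝ) * m ≤ h + m - 1 := by
      have h1 := Nat.ceil_lt_add_one (a := (h : ℝ) / m) (by positivity)
      rw [← numBlocks, ← hn] at h1
      have h2 : (n : ℝ) * m < h + m := by
        have := mul_lt_mul_of_pos_right h1 hm0
        rwa [add_mul, div_mul_cancel₀ _ hm0.ne', one_mul] at this
      have h3 : n * m + 1 ≤ h + m := by exact_mod_cast h2
      have h4 : (n : ℝ) * m + 1 ≤ h + m := by exact_mod_cast h3
      linarith
    have h2 : (k : ℝ) ^ m ≤ (2 : ℝ) ^ (l * (H + δ) - l * (C + δ)) := by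
      calc (k : ℝ) ^ m
          ≤ ((q : ℝ) ^ (n - (1 + l / (m * Real.logb 2 q) * (C + δ)))) ^ m := by gcongr
        _ = (2 : ℝ) ^ (Real.logb 2 q *
              ((n - (1 + l / (m * Real.logb 2 q) * (C + δ))) * m)) := by
            rw [← Real.rpow_natCast, ← Real.rpow_mul hq0.le, two_rpow_logb hq0]
        _ ≤ _ := by
            apply Real.rpow_le_rpow_of_exponent_le one_le_two
            have h5 : (n - (1 + l / (m * Real.logb 2 q) * (C + δ))) * m ≤
                l / Real.logb 2 q * (H + δ) - l / Real.logb 2 q * (C + δ) := by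
              have : (n - (1 + l / (m * Real.logb 2 q) * (C + δ))) * m =
                  n * m - m - l / Real.logb 2 q * (C + δ) := by
                field_simp
                ring
              rw [this]
              linarith
            refine (mul_le_mul_of_nonneg_left h5 hlog.le).trans (le_of_eq ?_)
            field_simp
    calc (J : ℝ) * ((k : ℝ) ^ m / N)
        ≤ (2 : ℝ) ^ (l * (C + 2 * (δ / 4))) *
            ((2 : ℝ) ^ (l * (H + δ) - l * (C + δ)) / (2 : ℝ) ^ (l * (H + δ))) := by gcongr
      _ = (2 : ℝ) ^ (-(l * (δ / 2))) := by
          rw [← Real.rpow_sub two_pos, ← Real.rpow_add two_pos]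
          congr 1
          ring

/-- The bound obtained from Markov's inequality for the number of solutions. -/
theorem markov_bound_le {q : ℕ} (hq : 1 < q) {n : ℕ} {A B ε p : ℝ} (hε : 0 < ε) (hε1 : ε ≤ 1)
    (hB : A + Real.logb 2 ε⁻¹ + 3 ≤ B) (hp : p ≤ (q : ℝ) ^ (-B)) :
    2 * ((q : ℝ) ^ n * p) / (q : ℝ) ^ (n - (1 + A)) ≤ ε / 2 := by
  have hq0 : (0 : ℝ) < q := by exact_mod_cast (by omega : 0 < q)
  have hq1 : (1 : ℝ) ≤ q := by exact_mod_cast hq.le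
  have hq2 : (2 : ℝ) ≤ q := by exact_mod_cast hq
  have hL : 0 ≤ Real.logb 2 ε⁻¹ := Real.logb_nonneg one_lt_two ((one_le_inv₀ hε).2 hε1)
  calc 2 * ((q : ℝ) ^ n * p) / (q : ℝ) ^ (n - (1 + A))
      ≤ 2 * ((q : ℝ) ^ n * (q : ℝ) ^ (-B)) / (q : ℝ) ^ (n - (1 + A)) := by gcongr
    _ = 2 * (q : ℝ) ^ (1 + A - B) := by
        rw [mul_div_assoc, ← Real.rpow_natCast, ← Real.rpow_add hq0, ← Real.rpow_sub hq0]
        congr 2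
        ring
    -- The additive 3 is used up here: one unit for the rounded block, one for the factor 2 of
    -- Markov's inequality, one for the target `ε / 2` instead of `ε`.
    _ ≤ 2 * (q : ℝ) ^ (-(2 + Real.logb 2 ε⁻¹)) := by
        gcongr
        linarith
    _ ≤ 2 * (2 : ℝ) ^ (-(2 + Real.logb 2 ε⁻¹)) := by
        gcongr 2 * ?_
        exact Real.rpow_le_rpow_of_nonpos two_pos hq2 (by linarith)
    _ = ε / 2 := by
        rw [neg_add, Real.rpow_add two_pos, Real.rpow_neg two_pos.le (Real.logb 2 ε⁻¹),
          Real.rpow_logb two_pos (by norm_num) (inv_pos.2 hε), inv_inv, Real.rpow_neg two_pos.le]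
        norm_num
        ring

/-! ### Decoding with side information -/

section Experiment

variable {V F 𝒳 : Type*} [Fintype V] [DecidableEq V] [Field F] [Fintype F] [DecidableEq F]
  [Fintype 𝒳] [DecidableEq 𝒳] {𝒴 : V → Type*} [∀ v, Fintype (𝒴 v)]

omit [DecidableEq F] in
theorem one_lt_card_field : 1 < Fintype.card F := Fintype.one_lt_card

/-- The network may be sampled before the bins. -/
theorem experiment_eq (M : ObliviousModel V) (P : PMF (𝒳 × ∀ v, 𝒴 v)) (src : Finset V)
    (l N n t : ℕ) [NeZero N] :
    experiment (F := F) M P src l N n t = (indep fun _ : Fin l => P).bind fun z =>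
      ((M.history t).bind (gossip src n)).bind fun L =>
        (PMF.uniformOfFintype ((Fin l → 𝒳) → Fin N)).map fun bin => (z, bin, L) := by
  rw [experiment]
  congr 1
  funext z
  have h1 : ∀ bin : (Fin l → 𝒳) → Fin N,
      ((M.history t).bind fun h => (gossip (F := F) src n h).map fun L => (z, bin, L)) =
        ((M.history t).bind (gossip src n)).bind fun L => PMF.pure (z, bin, L) := by
    intro bin
    rw [PMF.bind_bind]
    rfl
  simp only [h1]
  -- The order of sampling can be exchanged because neither the edge sets nor the coefficient
  -- vectors depend on the bins.
  rw [PMF.bind_comm]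
  rfl

/-- Sufficiently long after the flooding time, few vectors are orthogonal to all received ones,
except with probability `ε / 2`. -/
theorem many_orth_le {n : ℕ} (M : ObliviousModel V) {T α : ℝ}
    (hM : M.Floods (Fintype.card F) T α) (src : Finset V) (hsrc : src.Nonempty) (v : V) {A ε : ℝ}
    (hα : 0 < α) (hA : 0 ≤ A) (hε : 0 < ε) (hε1 : ε ≤ 1) {t : ℕ}
    (ht : T + 1 / α * (A + Real.logb 2 ε⁻¹ + 3) ≤ t) :
    ((M.history t).bind (gossip (F := F) src n)).toOuterMeasure
      {L | 1 < (orth (L v)).card ∧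
        ENNReal.ofReal ((Fintype.card F : ℝ) ^ (n - (1 + A))) ≤ (orth (L v)).card} ≤
      ENNReal.ofReal (ε / 2) := by
  obtain ⟨u, hu⟩ := hsrc
  have hL : 0 ≤ Real.logb 2 ε⁻¹ := Real.logb_nonneg one_lt_two ((one_le_inv₀ hε).2 hε1)
  have hB : A + Real.logb 2 ε⁻¹ + 3 ≤ α * (t - T) := by
    have h1 : 1 / α * (A + Real.logb 2 ε⁻¹ + 3) ≤ t - T := by linarith
    have h2 := mul_le_mul_of_nonneg_left h1 hα.le
    rwa [← mul_assoc, mul_one_div_cancel hα.ne', one_mul] at h2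
  have hk : 0 < (t : ℝ) - T := by
    by_contra hc
    have := mul_nonpos_of_nonneg_of_nonpos hα.le (not_lt.1 hc)
    linarith
  have hp := (hM u (t - T) hk).le
  rw [add_sub_cancel] at hp
  have hq0 : (0 : ℝ) < Fintype.card F := by exact_mod_cast Fintype.card_pos
  have hK : 0 < (Fintype.card F : ℝ) ^ (n - (1 + A)) := Real.rpow_pos_of_pos hq0 _
  have h1 := card_orth_markov ((M.history t).bind (gossip (F := F) src n)) v
    (ENNReal.ofReal (floodTail M ((Fintype.card F : ℝ≥0)⁻¹) {u} t))
    (ENNReal.ofReal ((Fintype.card F : ℝ) ^ (n - (1 + A))))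
    fun d hd => orthogonal_le_floodTail M src u hu d hd v t
  have h2 : (2 : ℝ≥0∞) * ((Fintype.card F : ℝ≥0∞) ^ n *
      ENNReal.ofReal (floodTail M ((Fintype.card F : ℝ≥0)⁻¹) {u} t)) =
      ENNReal.ofReal (2 * ((Fintype.card F : ℝ) ^ n *
        floodTail M ((Fintype.card F : ℝ≥0)⁻¹) {u} t)) := by
    rw [ENNReal.ofReal_mul two_pos.le, ENNReal.ofReal_mul (by positivity),
      ENNReal.ofReal_pow hq0.le, ENNReal.ofReal_natCast, ENNReal.ofReal_ofNat]
  rw [h2] at h1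
  refine (ENNReal.le_div_iff_mul_le (Or.inl (ENNReal.ofReal_pos.2 hK).ne')
    (Or.inl ENNReal.ofReal_ne_top)).2 h1 |>.trans ?_
  rw [← ENNReal.ofReal_div_of_pos hK]
  exact ENNReal.ofReal_le_ofReal (markov_bound_le one_lt_card_field hε hε1 hB hp)

open Classical in
-- Conditioning first on the samples and then on the received coefficient vectors leaves only the
-- bins random. The three terms are an atypical sample, too many solutions, and a confusion by
-- random binning.
theorem experiment_failure_le (M : ObliviousModel V) (P : PMF (𝒳 × ∀ v, 𝒴 v)) (src : Finset V)
    (η : ℝ) (v : V) {l m N n t : ℕ} [NeZero N] (b : Fin N → Fin n → Fin m → F)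
    (hb : Function.Injective b) {K c p₁ p₂ : ℝ≥0∞}
    (h₁ : (indep fun _ : Fin l => P).toOuterMeasure
      {z | ¬JointlyTypical (pairLaw P v) η (fun i => (z i).1) fun i => (z i).2 v} ≤ p₁)
    (h₂ : ((M.history t).bind (gossip (F := F) src n)).toOuterMeasure
      {L | 1 < (orth (L v)).card ∧ K ≤ (orth (L v)).card} ≤ p₂)
    (hc : ∀ (y : Fin l → 𝒴 v) (k : ℕ), ¬(1 < k ∧ K ≤ k) →
      ((Finset.univ.filter fun x' : Fin l → 𝒳 => JointlyTypical (pairLaw P v) η x' y).card *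
        ((k ^ m : ℕ) / (N : ℝ≥0∞)) ≤ c)) :
    (experiment (F := F) M P src l N n t).toOuterMeasure
      {ω | decode (pairLaw P v) η (fun x' => b (ω.2.1 x'))
        ((ω.2.2 v).image (mkPacket (b (ω.2.1 fun i => (ω.1 i).1)))) (fun i => (ω.1 i).2 v) =
          some fun i => (ω.1 i).1}ᶜ ≤ p₁ + (p₂ + c) := by
  rw [experiment_eq]
  refine le_trans (outerMeasure_bind_le _ _ _ {z | ¬JointlyTypical (pairLaw P v) η
    (fun i => (z i).1) fun i => (z i).2 v} (p₂ + c) fun z hz => ?_) ?_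
  · refine le_trans (outerMeasure_bind_le _ _ _ {L | 1 < (orth (L v)).card ∧
      K ≤ (orth (L v)).card} c fun L hL => ?_) ?_
    · rw [PMF.toOuterMeasure_map_apply]
      refine le_trans (MeasureTheory.measure_mono fun bin hbin => ?_)
        ((decode_failure_le (pairLaw P v) η b hb (L v) _ _ (not_not.1 hz)).trans (hc _ _ hL))
      exact hbin
    · exact add_le_add h₂ le_rfl
  · exact add_le_add h₁ le_rfl

open Classical in
-- The error budget is `ε/4` for atypical samples, `ε/2` for Markov's inequality and `ε/4` for the
-- union bound.
theorem decodingProb_ge (M : ObliviousModel V) {T α : ℝ} (hα : 0 < α)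
    (hM : M.Floods (Fintype.card F) T α) (P : PMF (𝒳 × ∀ v, 𝒴 v)) (src : Finset V)
    (hsrc : src.Nonempty) {ε δ : ℝ} (hε : 0 < ε) (hε1 : ε ≤ 1) (hδ : 0 < δ) (v : V) {l : ℕ}
    (hl : (2 : ℝ) ^ (-(l * (δ / 2))) ≤ ε / 4)
    (htyp : (indep fun _ : Fin l => P).toOuterMeasure
      {z | ¬JointlyTypical (pairLaw P v) (δ / 4) (fun i => (z i).1) fun i => (z i).2 v} ≤
        ENNReal.ofReal (ε / 4))
    {m : ℕ} (hm : 0 < m)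
    (label : Fin (numBins (sourceLaw P) δ l) ↪
      (Fin (numSymbols (sourceLaw P) δ l (Fintype.card F)) → F)) {t : ℕ}
    (ht : T + 1 / α * (l / (m * Real.logb 2 (Fintype.card F)) *
      (condEntropy (pairLaw P v) + δ) + Real.logb 2 ε⁻¹ + 3) ≤ t) :
    1 - ε ≤ decodingProb M P src δ (δ / 4) l m label v t := by
  have hN : (2 : ℝ) ^ (l * (entropy (sourceLaw P) + δ)) ≤ numBins (sourceLaw P) δ l :=
    Nat.le_ceil _
  have hh : numSymbols (sourceLaw P) δ l (Fintype.card F) =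
    ⌈(l : ℝ) / Real.logb 2 (Fintype.card F) * (entropy (sourceLaw P) + δ)⌉₊ := rfl
  refine one_sub_le_prob _ _ hε.le ?_
  revert label
  generalize numSymbols (sourceLaw P) δ l (Fintype.card F) = h at hh ⊢
  have hne : NeZero (numBins (sourceLaw P) δ l) := inferInstance
  intro label
  have hq1 : (1 : ℝ) < Fintype.card F := by exact_mod_cast one_lt_card_field (F := F)
  have hlog : 0 < Real.logb 2 (Fintype.card F) := Real.logb_pos one_lt_two hq1
  have hC := condEntropy_nonneg (pairLaw P v)
  have hfst : (pairLaw P v).map Prod.fst = sourceLaw P := by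
    rw [pairLaw, PMF.map_comp]; rfl
  have hsum : ENNReal.ofReal ε =
      ENNReal.ofReal (ε / 4) + (ENNReal.ofReal (ε / 2) + ENNReal.ofReal (ε / 4)) := by
    rw [← ENNReal.ofReal_add (by positivity) (by positivity),
      ← ENNReal.ofReal_add (by positivity) (by positivity)]
    congr 1
    ring
  rw [hsum]
  refine experiment_failure_le M P src (δ / 4) v (fun a => blocks m (label a))
    ((blocks_injective hm).comp label.injective) htyp
    (many_orth_le M hM src hsrc v hα (by positivity) hε hε1 ht) fun y k hk => ?_
  have hk' : k ≤ 1 ∨ (k : ℝ) ≤ (Fintype.card F : ℝ) ^ ((numBlocks h m : ℝ) -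
      (1 + l / (m * Real.logb 2 (Fintype.card F)) * (condEntropy (pairLaw P v) + δ))) := by
    by_contra hc
    rw [not_or, not_le, not_le] at hc
    refine hk ⟨hc.1, ?_⟩
    rw [← ENNReal.ofReal_natCast]
    exact ENNReal.ofReal_le_ofReal hc.2.le
  -- Two counts of the competitors: the one by `H(X)` serves a trivial `orth` and avoids appealing
  -- to `H(X|Y_v) ≤ H(X)`, the one by `H(X|Y_v)` serves the other case.
  have hJ₁ := card_typical_le (sourceLaw P) (δ / 4) l
  have hJ₂ := card_jointlyTypical_le (pairLaw P v) (δ / 4) y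
  have hJ : (Finset.univ.filter fun x' : Fin l → 𝒳 =>
      JointlyTypical (pairLaw P v) (δ / 4) x' y).card ≤
      (Finset.univ.filter fun x' : Fin l → 𝒳 => Typical (sourceLaw P) (δ / 4) x').card := by
    rw [← hfst]
    exact Finset.card_le_card (Finset.monotone_filter_right _ fun x' _ hx' => hx'.1)
  have hfinal := union_bound_le one_lt_card_field hm (entropy_nonneg (sourceLaw P)) hδ
    hh rfl hN ((Nat.cast_le.2 hJ).trans hJ₁) hJ₂ hk'
  have hN0 : (0 : ℝ) < numBins (sourceLaw P) δ l := (Real.rpow_pos_of_pos two_pos _).trans_le hN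
  refine le_trans (le_of_eq ?_) (ENNReal.ofReal_le_ofReal (hfinal.trans hl))
  rw [ENNReal.ofReal_mul (Nat.cast_nonneg _), ENNReal.ofReal_div_of_pos hN0,
    ENNReal.ofReal_natCast, ENNReal.ofReal_natCast, ENNReal.ofReal_pow (Nat.cast_nonneg _),
    ENNReal.ofReal_natCast, Nat.cast_pow]

end Experiment

end Gossip

/-! ### Choice of the slack and the block length -/

theorem mainTheorem2
    {V : Type*} [Fintype V] [DecidableEq V]
    (M : Gossip.ObliviousModel V) (T α : ℝ) (hα : 0 < α)
    (F : Type*) [Field F] [Fintype F] [DecidableEq F]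
    (hM : M.Floods (Fintype.card F) T α)
    {𝒳 : Type*} [Fintype 𝒳] [DecidableEq 𝒳] {𝒴 : V → Type*} [∀ v, Fintype (𝒴 v)]
    (P : PMF (𝒳 × ∀ v, 𝒴 v))
    (src : Finset V) (hsrc : src.Nonempty)
    (ε : ℝ) (hε : 0 < ε) (δ : ℝ) (hδ : 0 < δ) :
    ∃ η : ℝ, 0 < η ∧ ∃ l₀ : ℕ, ∀ l : ℕ, l₀ ≤ l →
      ∀ m : ℕ, 0 < m → ∀ s : ℝ, s = m * Real.logb 2 (Fintype.card F) →
      ∀ label : Fin (Gossip.numBins (Gossip.sourceLaw P) δ l) ↪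
        (Fin (Gossip.numSymbols (Gossip.sourceLaw P) δ l (Fintype.card F)) → F),
      ∀ v : V, ∀ t : ℕ,
        T + 1 / α * (l / s * (Gossip.condEntropy (Gossip.pairLaw P v) + δ)
          + Real.logb 2 ε⁻¹ + 3) ≤ t →
        1 - ε ≤ Gossip.decodingProb M P src δ η l m label v t := by
  refine ⟨δ / 4, by positivity, ?_⟩
  -- For `ε > 1` the claim is void; from here on `log ε⁻¹ ≥ 0`.
  rcases lt_or_ge 1 ε with hε1 | hε1
  · exact ⟨0, fun l _ m _ s _ label v t _ => (by linarith : 1 - ε ≤ 0).trans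
      (Gossip.prob_nonneg _ _)⟩
  choose l₁ hl₁ using fun v => Gossip.eventually_jointlyTypical P
    (fun z : 𝒳 × ∀ v, 𝒴 v => (z.1, z.2 v)) (η := δ / 4) (by positivity) (ε := ε / 4)
    (by positivity)
  obtain ⟨l₂, hl₂⟩ := exists_nat_ge (-Real.logb 2 (ε / 4) / (δ / 2))
  -- `l₂` makes `2^(-lδ/2) ≤ ε/4`; the supremum over the finitely many nodes makes the typicality
  -- threshold uniform in `v`.
  refine ⟨max l₂ (Finset.univ.sup l₁), fun l hl m hm s hs label v t ht => ?_⟩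
  rw [max_le_iff] at hl
  subst hs
  refine Gossip.decodingProb_ge M hα hM P src hsrc hε hε1 hδ v ?_
    (hl₁ v l ((Finset.le_sup (Finset.mem_univ v)).trans hl.2)) hm label ht
  rw [← Real.le_logb_iff_rpow_le one_lt_two (by positivity)]
  have h1 : (l₂ : ℝ) ≤ l := by exact_mod_cast hl.1
  have h2 := (div_le_iff₀ (by positivity)).1 (hl₂.trans h1)
  linarith
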